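/- **Theorem (Multijoints of flats).** Let $r \ge 2$, let $k_1, \dots, k_r$ be nonnegative integers, and put $d = k_1 + \cdots + k_r$. There is a constant $C_{k_1,\dots,k_r}$, depending only on $k_1, \dots, k_r$, such that the following holds for every field $\mathbb F$. For each $i = 1, \dots, r$ let $\mathcal F_i$ be a finite set of $k_i$-flats in $\mathbb F^d$, i.e. of nonempty affine subspaces of dimension $k_i$. Say that a point $p \in \mathbb F^d$ is a *joint* formed by flats $F_1, \dots, F_r$ if $p$ lies on every $F_i$ and the direction spaces of $F_1, \dots, F_r$ are linearly independent and together span $\mathbb F^d$. Then the number of points $p$ that are a joint formed by some choice of one flat $F_i$ from each $\mathcal F_i$ (each point being counted once) is finite and at most $$C_{k_1,\dots,k_r} \left(|\mathcal F_1| \cdots |\mathcal F_r|\right)^{1/(r-1)}.$$ -/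

import Mathlib

/-- A `k`-flat in an affine space: a nonempty affine subspace of dimension `k`. -/
def IsFlat {𝔽 V : Type*} [Field 𝔽] [AddCommGroup V] [Module 𝔽 V]
    (k : ℕ) (A : AffineSubspace 𝔽 V) : Prop :=
  (A : Set V).Nonempty ∧ Module.Finite 𝔽 A.direction ∧ Module.finrank 𝔽 A.direction = k

/-- The point `p` is a joint formed by the flats `A i`: every `A i` contains `p`, and the direction
spaces of the `A i` are independent and together span the whole space. -/
def IsJoint {𝔽 V ι : Type*} [Field 𝔽] [AddCommGroup V] [Module 𝔽 V]
    (A : ι → AffineSubspace 𝔽 V) (p : V) : Prop :=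
  (∀ i, p ∈ A i) ∧ iSupIndep (fun i => (A i).direction) ∧ ⨆ i, (A i).direction = ⊤

/-- The set of points that are a joint formed by taking one flat from each `F i`. A point is
counted once, however many choices of flats make it a joint. -/
def multijoints {𝔽 V ι : Type*} [Field 𝔽] [AddCommGroup V] [Module 𝔽 V]
    (F : ι → Finset (AffineSubspace 𝔽 V)) : Set V :=
  {p | ∃ A : ι → AffineSubspace 𝔽 V, (∀ i, A i ∈ F i) ∧ IsJoint A p}

/-! The proof is the polynomial method with handicaps. Take `N` joints, fix one flat of each family
through each joint, and let `n` be a large degree. Given handicaps `β`, rank the condition "vanish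
in order `a` at `q`" by `a - β q`, ties being broken by the point. On a single flat, impose the
conditions at the joints assigned to it in this order on polynomials of degree at most `n`. Those at
`p` that do not follow from earlier ones form `stdExp`, and their numbers add up over the flat to
the dimension of the polynomial space (`sum_ncard_stdExp_le`, `le_sum_ncard_stdExp`).

In the ambient space, look at the first condition that a nonzero polynomial violates. A suitably
minimal nonzero coefficient there has, along each of the `r` flats, an exponent in `stdExp`. Hence
the products over `i` of the counts sum to at least `(n + d).choose d`, and joints whose handicaps
lie more than `n` above all the others suffice for this (`choose_le_sum_prod_ncard_stdExp`).

Raising one handicap can increase only the product at that joint, and by little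
(`ncard_stdExp_update_self`). So `exists_balanced` finds handicaps for which every product is at
least `(n + d).choose d / (2 * N)`. By `card_pow_mul_le_prod`, `N ^ r` times this is at most the
product over `i` of `(F i).card * (n + k i).choose (k i)`. As `∑ k i = d`, the powers of `n` cancel
for large `n` (`exists_degree`), which leaves `N ^ (r - 1) ≤ 2 * (d! + 1) * ∏ (F i).card`. -/

namespace MultijointBound

open MvPolynomial

/-! ### Vanishing to high order at a point. -/

section Polynomials

variable {σ τ R : Type*} [CommRing R]

/-- The ideal of polynomials vanishing at `a`. -/
noncomputable def pointIdeal (a : σ → R) : Ideal (MvPolynomial σ R) := RingHom.ker (eval a)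

lemma mem_pointIdeal {a : σ → R} {f : MvPolynomial σ R} : f ∈ pointIdeal a ↔ eval a f = 0 :=
  RingHom.mem_ker

/-- Translation of a polynomial: `translate a f` is `f (· + a)`. -/
noncomputable def translate (a : σ → R) : MvPolynomial σ R →ₐ[R] MvPolynomial σ R :=
  aeval fun i => X i + C (a i)

@[simp]
lemma translate_X (a : σ → R) (i : σ) : translate a (X i) = X i + C (a i) := by
  simp [translate]

lemma algHom_mem_pointIdeal_pow (φ : MvPolynomial σ R →ₐ[R] MvPolynomial τ R) {a : σ → R}
    {b : τ → R} (h : ∀ i, eval b (φ (X i)) = a i) {f : MvPolynomial σ R} {m : ℕ}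
    (hf : f ∈ pointIdeal a ^ m) : φ f ∈ pointIdeal b ^ m := by
  have hφ : ∀ g, eval b (φ g) = eval a g := by
    intro g
    have : ((aeval b : MvPolynomial τ R →ₐ[R] R).comp φ) = aeval a := by
      ext i
      simpa [aeval_eq_eval] using h i
    simpa [aeval_eq_eval] using congrArg (fun ψ => ψ g) this
  have hle : (pointIdeal a).map φ ≤ pointIdeal b := by
    rw [Ideal.map_le_iff_le_comap]
    intro g hg
    rw [Ideal.mem_comap, mem_pointIdeal, hφ]
    exact mem_pointIdeal.1 hg
  have := Ideal.mem_map_of_mem φ hf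
  rw [Ideal.map_pow] at this
  exact Ideal.pow_right_mono hle m this

lemma translate_translate (a b : σ → R) (f : MvPolynomial σ R) :
    translate a (translate b f) = translate (a + b) f := by
  have : (translate a).comp (translate b) = translate (a + b) := by
    ext1 i
    simp [algHom_C, add_assoc]
  simpa using congrArg (fun ψ => ψ f) this

lemma translate_zero (f : MvPolynomial σ R) : translate (0 : σ → R) f = f := by
  have : translate (0 : σ → R) = AlgHom.id R _ := by
    ext1 i
    simp
  simpa using congrArg (fun ψ => ψ f) this

lemma translate_neg_translate (a : σ → R) (f : MvPolynomial σ R) :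
    translate (-a) (translate a f) = f := by
  rw [translate_translate, neg_add_cancel, translate_zero]

lemma translate_translate_neg (a : σ → R) (f : MvPolynomial σ R) :
    translate a (translate (-a) f) = f := by
  rw [translate_translate, add_neg_cancel, translate_zero]

lemma pointIdeal_zero : pointIdeal (0 : σ → R) = idealOfVars σ R := by
  ext f
  rw [mem_pointIdeal, ← pow_one (idealOfVars σ R), mem_pow_idealOfVars_iff']
  constructor
  · intro h x hx
    have : x = 0 := by
      rw [← Finsupp.degree_eq_zero_iff]
      omega
    rw [this, ← constantCoeff_eq, ← eval_zero]
    exact h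
  · intro h
    rw [eval_zero, constantCoeff_eq]
    exact h 0 (by simp)

lemma translate_mem_pointIdeal_pow {a b c : σ → R} (hc : c + a = b) {f : MvPolynomial σ R} {m : ℕ}
    (hf : f ∈ pointIdeal b ^ m) : translate a f ∈ pointIdeal c ^ m :=
  algHom_mem_pointIdeal_pow _ (by intro i; simp [← hc]) hf

/-- Links the multiplicative form of the order of vanishing with Taylor coefficients. No derivatives
occur, so the characteristic plays no role. -/
lemma mem_pointIdeal_pow_iff {a : σ → R} {f : MvPolynomial σ R} {m : ℕ} :
    f ∈ pointIdeal a ^ m ↔ ∀ e : σ →₀ ℕ, e.degree < m → coeff e (translate a f) = 0 := by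
  rw [← mem_pow_idealOfVars_iff', ← pointIdeal_zero]
  constructor
  · exact translate_mem_pointIdeal_pow (zero_add a)
  · intro h
    rw [← translate_neg_translate a f]
    exact translate_mem_pointIdeal_pow (add_neg_cancel a) h

lemma totalDegree_aeval_le (φ : MvPolynomial σ R →ₐ[R] MvPolynomial τ R)
    (hφ : ∀ i, (φ (X i)).totalDegree ≤ 1) (f : MvPolynomial σ R) :
    (φ f).totalDegree ≤ f.totalDegree := by
  conv_lhs => rw [f.as_sum, map_sum]
  refine totalDegree_finsetSum_le fun e he => ?_
  refine le_trans ?_ (le_totalDegree he)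
  rw [monomial_eq, map_mul, algHom_C, Finsupp.prod, map_prod]
  refine (totalDegree_mul _ _).trans ?_
  rw [show algebraMap R (MvPolynomial τ R) = C from rfl, totalDegree_C, zero_add]
  refine (totalDegree_finsetProd _ _).trans ?_
  refine Finset.sum_le_sum fun i _ => ?_
  rw [map_pow]
  refine (totalDegree_pow _ _).trans ?_
  simpa using Nat.mul_le_mul_left (e i) (hφ i)

lemma totalDegree_translate_le (a : σ → R) (f : MvPolynomial σ R) :
    (translate a f).totalDegree ≤ f.totalDegree := by
  refine totalDegree_aeval_le _ (fun i => ?_) f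
  rw [translate_X]
  refine (totalDegree_add _ _).trans (max_le ?_ (by simp))
  exact (totalDegree_monomial_le _ _).trans (by simp)

lemma eq_zero_of_mem_pointIdeal_pow {a : σ → R} {f : MvPolynomial σ R} {n : ℕ}
    (hn : f.totalDegree ≤ n) (hf : f ∈ pointIdeal a ^ (n + 1)) : f = 0 := by
  rw [← translate_neg_translate a f]
  suffices translate a f = 0 by rw [this, map_zero]
  ext e
  rw [coeff_zero]
  by_cases he : e.degree < n + 1
  · exact mem_pointIdeal_pow_iff.1 hf e he
  · refine coeff_eq_zero_of_totalDegree_lt ?_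
    have := totalDegree_translate_le a f
    rw [Finsupp.degree_apply] at he
    omega

end Polynomials

/-! ### Counting exponents, and triangular independence. -/

section Dimension

lemma card_degree_eq (σ : Type*) [Fintype σ] (n : ℕ) :
    Nat.card {e : σ →₀ ℕ | e.degree = n} = (Fintype.card σ).multichoose n := by
  classical
  have : {e : σ →₀ ℕ | e.degree = n} = ((Finset.univ : Finset σ).finsuppAntidiag n : Set _) := by
    ext e
    simp [Finset.mem_finsuppAntidiag, Finsupp.degree_eq_sum]
  rw [this, Nat.card_coe_set_eq, Set.ncard_coe_finset,
    Finset.card_finsuppAntidiag_nat_eq_multichoose, Finset.card_univ]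

lemma card_degree_le (σ : Type*) [Fintype σ] (n : ℕ) :
    {e : σ →₀ ℕ | e.degree ≤ n}.ncard = (n + Fintype.card σ).choose (Fintype.card σ) := by
  induction n with
  | zero =>
    have : {e : σ →₀ ℕ | e.degree ≤ 0} = {0} := by
      ext e
      exact nonpos_iff_eq_zero.trans (Finsupp.degree_eq_zero_iff e)
    rw [this]
    simp
  | succ n ih =>
    have h : {e : σ →₀ ℕ | e.degree ≤ n + 1} =
        {e : σ →₀ ℕ | e.degree ≤ n} ∪ {e : σ →₀ ℕ | e.degree = n + 1} := by
      ext e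
      simp only [Set.mem_ofPred_eq, Set.mem_union]
      omega
    have hfin := Finsupp.finite_of_degree_le (σ := σ) (n + 1)
    have h1 : {e : σ →₀ ℕ | e.degree ≤ n}.Finite :=
      hfin.subset fun e he => by simp only [Set.mem_ofPred_eq] at he ⊢; omega
    have h2 : {e : σ →₀ ℕ | e.degree = n + 1}.Finite :=
      hfin.subset fun e he => by simp only [Set.mem_ofPred_eq] at he ⊢; omega
    rw [h, Set.ncard_union_eq ?_ h1 h2, ih, ← Nat.card_coe_set_eq {e : σ →₀ ℕ | e.degree = n + 1},
      card_degree_eq]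
    · rcases hk : Fintype.card σ with _ | k
      · simp
      · rw [Nat.multichoose_eq, show k + 1 + (n + 1) - 1 = n + 1 + k by omega,
          Nat.choose_symm_add, show n + 1 + (k + 1) = (n + 1 + k) + 1 by omega,
          Nat.choose_succ_succ, show n + (k + 1) = n + 1 + k by omega, add_comm]
    · rw [Set.disjoint_left]
      intro e he he'
      simp only [Set.mem_ofPred_eq] at he he'
      omega

lemma finrank_restrictTotalDegree (σ 𝔽 : Type*) [Fintype σ] [Field 𝔽] (n : ℕ) :
    Module.finrank 𝔽 (restrictTotalDegree σ 𝔽 n) =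
      (n + Fintype.card σ).choose (Fintype.card σ) := by
  rw [← card_degree_le, ← Nat.card_coe_set_eq]
  exact Module.finrank_eq_nat_card_basis (basisRestrictSupport 𝔽 _)

/-- Vectors that are triangular with respect to a family of functionals are independent. -/
lemma linearIndependent_of_triangular {𝔽 M ι κ : Type*} [Field 𝔽] [AddCommGroup M] [Module 𝔽 M]
    [LinearOrder κ] (K : ι → κ) (hK : Function.Injective K) (v : ι → M) (c : ι → M →ₗ[𝔽] 𝔽)
    (h0 : ∀ i j, K i < K j → c i (v j) = 0) (h1 : ∀ i, c i (v i) ≠ 0) :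
    LinearIndependent 𝔽 v := by
  classical
  rw [linearIndependent_iff]
  intro l hl
  by_contra hne
  obtain ⟨i, hi, hmin⟩ := l.support.exists_min_image K (Finsupp.support_nonempty_iff.2 hne)
  have h := congrArg (c i) hl
  rw [Finsupp.linearCombination_apply, Finsupp.sum, map_sum, map_zero,
    Finset.sum_eq_single i] at h
  · rw [map_smul, smul_eq_mul, mul_eq_zero] at h
    exact h.elim (Finsupp.mem_support_iff.1 hi) (h1 i)
  · intro j hj hji
    rw [map_smul, h0 i j (lt_of_le_of_ne (hmin j hj) fun h => hji (hK h).symm), smul_zero]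
  · exact fun h => absurd hi h

end Dimension

end MultijointBound

namespace MultijointBound

open MvPolynomial

/-! ### Standard exponents on one flat, and their dependence on the handicaps. -/

section StandardExponents

variable {ι : Type*} {𝔽 : Type*} [Field 𝔽] {k : ℕ}

/-- The rank in time of the vanishing condition of order `a` at the point `q`, where `β` are the
handicaps. -/
def key (β : ι → ℕ) (q : ι) (a : ℕ) : ℤ ×ₗ ι := toLex ((a : ℤ) - β q, q)

lemma key_injective (β : ι → ℕ) {q p : ι} {a b : ℕ} (h : key β q a = key β p b) :
    q = p ∧ a = b := by
  have h' : ((a : ℤ) - β q, q) = ((b : ℤ) - β p, p) := toLex.injective h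
  rw [Prod.mk.injEq] at h'
  obtain ⟨h1, rfl⟩ := h'
  exact ⟨rfl, by omega⟩

variable [LinearOrder ι]

lemma key_lt_key {β : ι → ℕ} {q p : ι} {a b : ℕ} :
    key β q a < key β p b ↔
      (a : ℤ) - β q < b - β p ∨ (a : ℤ) - β q = b - β p ∧ q < p := by
  simp [key, Prod.Lex.toLex_lt_toLex]

/-- The polynomial `f` shows that vanishing of the coefficient of exponent `e` at `x p` does not
follow from the earlier vanishing conditions at the points `x q`, `q ∈ S`. -/
structure IsWitness (β : ι → ℕ) (S : Finset ι) (x : ι → Fin k → 𝔽) (n : ℕ) (p : ι)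
    (e : Fin k →₀ ℕ) (f : MvPolynomial (Fin k) 𝔽) : Prop where
  totalDegree_le : f.totalDegree ≤ n
  mem_pow : ∀ q ∈ S, ∀ a, key β q a < key β p e.degree → f ∈ pointIdeal (x q) ^ (a + 1)
  coeff_eq_zero : ∀ e' : Fin k →₀ ℕ, e'.degree = e.degree → toLex e' < toLex e →
    coeff e' (translate (x p) f) = 0
  coeff_ne_zero : coeff e (translate (x p) f) ≠ 0

/-- The exponents at `x p` whose vanishing conditions are independent of the earlier ones. -/
def stdExp (β : ι → ℕ) (S : Finset ι) (x : ι → Fin k → 𝔽) (n : ℕ) (p : ι) :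
    Set (Fin k →₀ ℕ) :=
  {e | ∃ f, IsWitness β S x n p e f}

lemma degree_le_of_mem_stdExp {β : ι → ℕ} {S : Finset ι} {x : ι → Fin k → 𝔽} {n : ℕ} {p : ι}
    {e : Fin k →₀ ℕ} (he : e ∈ stdExp β S x n p) : e.degree ≤ n := by
  obtain ⟨f, hf⟩ := he
  rw [Finsupp.degree_apply]
  by_contra! h
  exact hf.coeff_ne_zero (coeff_eq_zero_of_totalDegree_lt
    (((totalDegree_translate_le _ _).trans hf.totalDegree_le).trans_lt h))

lemma finite_stdExp (β : ι → ℕ) (S : Finset ι) (x : ι → Fin k → 𝔽) (n : ℕ) (p : ι) :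
    (stdExp β S x n p).Finite :=
  (Finsupp.finite_of_degree_le n).subset fun _ => degree_le_of_mem_stdExp

instance (β : ι → ℕ) (S : Finset ι) (x : ι → Fin k → 𝔽) (n : ℕ) (p : ι) :
    Finite (stdExp β S x n p) := finite_stdExp β S x n p

/-- Take the violated condition of least rank. At its own point the lower orders come earlier, so
`m` is the exact order of vanishing there. -/
lemma exists_first_nonvanishing {σ : Type*} (β : ι → ℕ) {S : Finset ι} (hS : S.Nonempty)
    (x : ι → σ → 𝔽) {n : ℕ} {g : MvPolynomial σ 𝔽} (hg : g ≠ 0) (hn : g.totalDegree ≤ n) :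
    ∃ p ∈ S, ∃ m ≤ n, g ∈ pointIdeal (x p) ^ m ∧ g ∉ pointIdeal (x p) ^ (m + 1) ∧
      ∀ q ∈ S, ∀ a, key β q a < key β p m → g ∈ pointIdeal (x q) ^ (a + 1) := by
  classical
  have hlast : ∀ q, g ∉ pointIdeal (x q) ^ (n + 1) := fun q h =>
    hg (eq_zero_of_mem_pointIdeal_pow hn h)
  -- By `hlast` every point has a violated condition of order at most `n`, so a finite search
  -- suffices.
  let T := (S ×ˢ Finset.range (n + 1)).filter
    fun t => g ∉ pointIdeal (x t.1) ^ (t.2 + 1)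
  have hT : T.Nonempty := by
    obtain ⟨q, hq⟩ := hS
    exact ⟨(q, n), by simp [T, hq, hlast]⟩
  obtain ⟨⟨p, m⟩, hpm, hmin⟩ := T.exists_min_image (fun t => key β t.1 t.2) hT
  simp only [T, Finset.mem_filter, Finset.mem_product, Finset.mem_range] at hpm
  have hearlier : ∀ q ∈ S, ∀ a, key β q a < key β p m → g ∈ pointIdeal (x q) ^ (a + 1) := by
    intro q hq a ha
    by_contra hcon
    have key' : ∀ b ≤ n, b ≤ a → g ∈ pointIdeal (x q) ^ (b + 1) := by
      intro b hb hba
      by_contra hcon'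
      have hle := hmin (q, b) (by
        simp only [T, Finset.mem_filter, Finset.mem_product, Finset.mem_range]
        exact ⟨⟨hq, by omega⟩, hcon'⟩)
      refine absurd (lt_of_lt_of_le ha hle) (not_lt.2 ?_)
      rcases hba.eq_or_lt with rfl | hlt
      · exact le_rfl
      · exact (key_lt_key.2 (Or.inl (by dsimp only; omega))).le
    rcases le_total a n with han | han
    · exact hcon (key' a han le_rfl)
    · exact hlast q (key' n le_rfl han)
  refine ⟨p, hpm.1.1, m, by omega, ?_, hpm.2, hearlier⟩
  rcases m with _ | m
  · simp
  · exact hearlier p hpm.1.1 m (key_lt_key.2 (Or.inl (by push_cast; omega)))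

lemma card_sigma_stdExp (β : ι → ℕ) (S : Finset ι) (x : ι → Fin k → 𝔽) (n : ℕ) :
    Nat.card (Σ p : S, stdExp β S x n p) = ∑ p ∈ S, (stdExp β S x n p).ncard := by
  rw [Nat.card_sigma, ← Finset.sum_coe_sort S]
  simp [Nat.card_coe_set_eq]

/-- The coefficient of exponent `e` at the point `a`, as a functional on polynomials. -/
noncomputable def coeffAt {σ : Type*} (a : σ → 𝔽) (e : σ →₀ ℕ) (n : ℕ) :
    restrictTotalDegree σ 𝔽 n →ₗ[𝔽] 𝔽 :=
  lcoeff 𝔽 e ∘ₗ (translate a).toLinearMap ∘ₗ Submodule.subtype _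

@[simp]
lemma coeffAt_apply {σ : Type*} (a : σ → 𝔽) (e : σ →₀ ℕ) (n : ℕ)
    (f : restrictTotalDegree σ 𝔽 n) : coeffAt a e n f = coeff e (translate a f.1) := rfl

/-- The witnesses are triangular with respect to the ranked coefficient functionals, hence
independent. -/
lemma sum_ncard_stdExp_le (β : ι → ℕ) (S : Finset ι) (x : ι → Fin k → 𝔽) (n : ℕ) :
    ∑ p ∈ S, (stdExp β S x n p).ncard ≤ (n + k).choose k := by
  classical
  have := Fintype.ofFinite (Σ p : S, stdExp β S x n p)
  have hf : ∀ t : Σ p : S, stdExp β S x n p, ∃ f, IsWitness β S x n t.1 t.2.1 f :=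
    fun t => t.2.2
  choose f hf using hf
  let v : (Σ p : S, stdExp β S x n p) → restrictTotalDegree (Fin k) 𝔽 n :=
    fun t => ⟨f t, (mem_restrictTotalDegree _ _ _).2 (hf t).totalDegree_le⟩
  have hv : LinearIndependent 𝔽 v := by
    refine linearIndependent_of_triangular
      (fun t => toLex (key β t.1.1 t.2.1.degree, toLex t.2.1)) ?_ v
      (fun t => coeffAt (x t.1) t.2.1 n) ?_ (fun t => (hf t).coeff_ne_zero)
    · rintro ⟨⟨q, hq⟩, ⟨e, he⟩⟩ ⟨⟨p, hp⟩, ⟨e', he'⟩⟩ h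
      have h' := toLex.injective h
      simp only [Prod.mk.injEq] at h'
      obtain ⟨h1, h2⟩ := h'
      obtain ⟨rfl, -⟩ := key_injective β h1
      obtain rfl := toLex.injective h2
      rfl
    · rintro ⟨⟨q, hq⟩, ⟨e, he⟩⟩ ⟨⟨p, hp⟩, ⟨e', he'⟩⟩ h
      rw [Prod.Lex.toLex_lt_toLex] at h
      rw [coeffAt_apply]
      rcases h with h | ⟨h1, h2⟩
      · exact mem_pointIdeal_pow_iff.1 ((hf ⟨⟨p, hp⟩, ⟨e', he'⟩⟩).mem_pow q hq _ h) e (by simp)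
      · obtain ⟨rfl, hd⟩ := key_injective β h1
        exact (hf ⟨⟨q, hp⟩, ⟨e', he'⟩⟩).coeff_eq_zero e hd h2
  have h := hv.fintype_card_le_finrank
  rwa [← Nat.card_eq_fintype_card, card_sigma_stdExp, finrank_restrictTotalDegree,
    Fintype.card_fin] at h

/-- A polynomial whose standard coefficients all vanish is zero: otherwise it would itself witness
that its first nonzero coefficient is standard. -/
lemma le_sum_ncard_stdExp (β : ι → ℕ) {S : Finset ι} (hS : S.Nonempty) (x : ι → Fin k → 𝔽)
    (n : ℕ) : (n + k).choose k ≤ ∑ p ∈ S, (stdExp β S x n p).ncard := by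
  classical
  have := Fintype.ofFinite (Σ p : S, stdExp β S x n p)
  let c : restrictTotalDegree (Fin k) 𝔽 n →ₗ[𝔽] ((Σ p : S, stdExp β S x n p) → 𝔽) :=
    LinearMap.pi fun t => coeffAt (x t.1) t.2.1 n
  have hc : Function.Injective c := by
    rw [injective_iff_map_eq_zero]
    rintro ⟨f, hf⟩ hcf
    rw [mem_restrictTotalDegree] at hf
    by_contra hne
    have hf0 : f ≠ 0 := fun h => hne (Subtype.ext h)
    obtain ⟨p, hp, m, -, hm, hm', hearlier⟩ := exists_first_nonvanishing β hS x hf0 hf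
    rw [mem_pointIdeal_pow_iff] at hm hm'
    push Not at hm'
    obtain ⟨e₀, he₀, hne₀⟩ := hm'
    obtain ⟨e, he, hmin⟩ := ((translate (x p) f).support.filter
      fun e => e.degree = m).exists_min_image toLex ⟨e₀, by
        rw [Finset.mem_filter, mem_support_iff]
        refine ⟨hne₀, ?_⟩
        by_contra h
        exact hne₀ (hm e₀ (by omega))⟩
    rw [Finset.mem_filter, mem_support_iff] at he
    have hmem : e ∈ stdExp β S x n p := by
      refine ⟨f, hf, ?_, ?_, he.1⟩
      · rw [he.2]
        exact hearlier
      · intro e' hd hlt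
        by_contra hcon
        refine absurd (hmin e' ?_) (not_le.2 hlt)
        rw [Finset.mem_filter, mem_support_iff]
        exact ⟨hcon, hd.trans he.2⟩
    exact he.1 (congrFun hcf ⟨⟨p, hp⟩, ⟨e, hmem⟩⟩)
  have h := LinearMap.finrank_le_finrank_of_injective hc
  rwa [Module.finrank_fintype_fun_eq_card, ← Nat.card_eq_fintype_card, card_sigma_stdExp,
    finrank_restrictTotalDegree, Fintype.card_fin] at h

lemma stdExp_mono (β : ι → ℕ) (S : Finset ι) (x : ι → Fin k → 𝔽) {n n' : ℕ} (hn : n ≤ n')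
    (p : ι) : stdExp β S x n p ⊆ stdExp β S x n' p := fun _ ⟨f, hf⟩ =>
  ⟨f, hf.totalDegree_le.trans hn, hf.mem_pow, hf.coeff_eq_zero, hf.coeff_ne_zero⟩

/-- The totals over `S` are known exactly in both degrees and no count drops as the degree grows, so
one point gains at most the increase of the total. -/
lemma ncard_stdExp_le_add {N : ℕ} (β : ι → ℕ) {S : Finset ι} (x : ι → Fin k → 𝔽) (n : ℕ)
    {p : ι} (hp : p ∈ S) :
    (stdExp β S x (n + N) p).ncard + (n + k).choose k ≤
      (stdExp β S x n p).ncard + (n + N + k).choose k := by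
  have h1 := le_sum_ncard_stdExp β ⟨p, hp⟩ x n
  have h2 := sum_ncard_stdExp_le β S x (n + N)
  rw [← Finset.add_sum_erase _ _ hp] at h1 h2
  have h3 : ∑ q ∈ S.erase p, (stdExp β S x n q).ncard ≤
      ∑ q ∈ S.erase p, (stdExp β S x (n + N) q).ncard :=
    Finset.sum_le_sum fun q _ =>
      Set.ncard_le_ncard (stdExp_mono β S x (by omega) q) (finite_stdExp _ _ _ _ _)
  omega

/-- Conditions at `p` only move earlier, so a witness at `q` has no fewer conditions to meet than
before. -/
lemma stdExp_update_subset_of_ne (β : ι → ℕ) (S : Finset ι) (x : ι → Fin k → 𝔽) (n : ℕ)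
    {p q : ι} (h : q ≠ p) :
    stdExp (Function.update β p (β p + 1)) S x n q ⊆ stdExp β S x n q := by
  rintro e ⟨f, hf⟩
  refine ⟨f, hf.totalDegree_le, fun q' hq' a ha => hf.mem_pow q' hq' a ?_, hf.coeff_eq_zero,
    hf.coeff_ne_zero⟩
  rw [key_lt_key] at ha ⊢
  rw [Function.update_of_ne h]
  by_cases hq : q' = p
  · subst hq
    rw [Function.update_self]
    omega
  · rwa [Function.update_of_ne hq]

/-- A polynomial of degree at most `#S` vanishing at all the points `x q ≠ x p`, `q ∈ S`, but not
at `x p`. -/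
lemma exists_separating {σ : Type*} (S : Finset ι) (x : ι → σ → 𝔽)
    (hx : Set.InjOn x S) {p : ι} (hp : p ∈ S) :
    ∃ l : MvPolynomial σ 𝔽, l.totalDegree ≤ S.card ∧ eval (x p) l ≠ 0 ∧
      ∀ q ∈ S, q ≠ p → l ∈ pointIdeal (x q) := by
  classical
  have h : ∀ q, ∃ l : MvPolynomial σ 𝔽, l.totalDegree ≤ 1 ∧
      (q ∈ S → q ≠ p → eval (x p) l ≠ 0) ∧ l ∈ pointIdeal (x q) := by
    intro q
    by_cases hq : q ∈ S ∧ q ≠ p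
    · obtain ⟨i, hi⟩ := Function.ne_iff.1 fun h => hq.2 (hx hq.1 hp h)
      refine ⟨X i - C (x q i), (totalDegree_sub _ _).trans (by simp), fun _ _ => ?_, ?_⟩
      · simpa [sub_eq_zero] using hi.symm
      · simp [mem_pointIdeal]
    · exact ⟨0, by simp, fun h1 h2 => absurd ⟨h1, h2⟩ hq, by simp⟩
  choose l hl1 hl2 hl3 using h
  refine ⟨∏ q ∈ S.erase p, l q, ?_, ?_, ?_⟩
  · refine (totalDegree_finsetProd _ _).trans ((Finset.sum_le_sum fun q _ => hl1 q).trans ?_)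
    simpa using Finset.card_le_card (Finset.erase_subset p S)
  · rw [map_prod, Finset.prod_ne_zero_iff]
    intro q hq
    rw [Finset.mem_erase] at hq
    exact hl2 q hq.2 hq.1
  · intro q hq hqp
    exact Ideal.mem_of_dvd _ (Finset.dvd_prod_of_mem l (Finset.mem_erase.2 ⟨hqp, hq⟩)) (hl3 q)

lemma coeff_mul_of_forall_lt {σ R : Type*} [CommRing R] (l f : MvPolynomial σ R) (e : σ →₀ ℕ)
    (h : ∀ e', e'.degree < e.degree → coeff e' f = 0) :
    coeff e (l * f) = coeff 0 l * coeff e f := by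
  classical
  rw [coeff_mul, Finset.sum_eq_single (0, e)]
  · rintro ⟨a, b⟩ hab hne
    rw [Finset.HasAntidiagonal.mem_antidiagonal] at hab
    have hab' : a + b = e := hab
    rw [h b, mul_zero]
    have ha : a ≠ 0 := by
      rintro rfl
      rw [zero_add] at hab'
      exact hne (by rw [hab'])
    have : a.degree ≠ 0 := fun h => ha ((Finsupp.degree_eq_zero_iff a).1 h)
    rw [← hab', map_add]
    omega
  · intro h
    simp at h

lemma coeff_zero_translate {σ R : Type*} [CommRing R] (a : σ → R) (f : MvPolynomial σ R) :
    coeff 0 (translate a f) = eval a f := by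
  have : (aeval (0 : σ → R)).comp (translate a) = aeval a := by
    ext i
    simp
  have h := congrArg (fun ψ => ψ f) this
  simp only [AlgHom.comp_apply, aeval_eq_eval] at h
  rw [← h, ← constantCoeff_eq, ← eval_zero]

/-- Multiply a witness by a polynomial separating `p` from the other points. One extra order of
vanishing at each of those makes up for the handicap step, and at `p` the lowest-order coefficients
are only scaled by a nonzero constant. -/
lemma stdExp_update_self_subset (β : ι → ℕ) {S : Finset ι} {x : ι → Fin k → 𝔽}
    (hx : Set.InjOn x S) (n : ℕ) {p : ι} (hp : p ∈ S) :
    stdExp (Function.update β p (β p + 1)) S x n p ⊆ stdExp β S x (n + S.card) p := by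
  rintro e ⟨f, hf⟩
  obtain ⟨l, hl1, hl2, hl3⟩ := exists_separating S x hx hp
  have hmem : ∀ q ∈ S, ∀ a, q = p → a < e.degree → f ∈ pointIdeal (x q) ^ (a + 1) := by
    rintro q hq a rfl ha
    exact hf.mem_pow q hq a (key_lt_key.2 (Or.inl (by omega)))
  have hmul : ∀ e' : Fin k →₀ ℕ, e'.degree = e.degree → coeff e' (translate (x p) (l * f)) =
      eval (x p) l * coeff e' (translate (x p) f) := by
    intro e' he'
    rw [map_mul, coeff_mul_of_forall_lt, coeff_zero_translate]
    intro e'' he''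
    exact mem_pointIdeal_pow_iff.1 (hmem p hp e''.degree rfl (by omega)) e'' (by omega)
  refine ⟨l * f, ?_, ?_, ?_, ?_⟩
  · have := hf.totalDegree_le
    exact (totalDegree_mul _ _).trans (by omega)
  · intro q hq a ha
    by_cases hqp : q = p
    · subst hqp
      exact Ideal.mul_mem_left _ _ (hmem q hq a rfl (by
        rcases key_lt_key.1 ha with h | h
        · omega
        · exact absurd h.2 (lt_irrefl _)))
    · rw [pow_succ']
      refine Ideal.mul_mem_mul (hl3 q hq hqp) ?_
      rcases a with _ | a
      · simp
      · refine hf.mem_pow q hq a ?_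
        rw [key_lt_key] at ha ⊢
        rw [Function.update_self, Function.update_of_ne hqp]
        push_cast at ha ⊢
        exact ha.imp (fun h => by omega) fun h => ⟨by omega, h.2⟩
  · intro e' hd hlt
    rw [hmul e' hd, hf.coeff_eq_zero e' hd hlt, mul_zero]
  · rw [hmul e rfl]
    exact mul_ne_zero hl2 hf.coeff_ne_zero

lemma ncard_stdExp_update_self {N : ℕ} (β : ι → ℕ) {S : Finset ι} (hN : S.card ≤ N)
    {x : ι → Fin k → 𝔽} (hx : Set.InjOn x S) (n : ℕ) {p : ι} (hp : p ∈ S) :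
    (stdExp (Function.update β p (β p + 1)) S x n p).ncard + (n + k).choose k ≤
      (stdExp β S x n p).ncard + (n + N + k).choose k := by
  have h1 := Set.ncard_le_ncard ((stdExp_update_self_subset β hx n hp).trans
    (stdExp_mono β S x (by omega : n + S.card ≤ n + N) p)) (finite_stdExp _ _ _ _ _)
  have h2 := ncard_stdExp_le_add (N := N) β x n hp
  omega

end StandardExponents

end MultijointBound

namespace MultijointBound

open MvPolynomial

/-! ### Coefficients in the directions transverse to a flat. -/

section Slice

variable {σ τ R : Type*} [CommRing R]

open Classical in
/-- Regard a polynomial as a polynomial in the variables outside the range of `j`, whose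
coefficients are polynomials in the variables in the range of `j`. -/
noncomputable def sliceHom (j : σ → τ) :
    MvPolynomial τ R →ₐ[R] MvPolynomial τ (MvPolynomial σ R) :=
  aeval fun t => if h : ∃ s, j s = t then C (X h.choose) else X t

lemma sliceHom_X_apply {j : σ → τ} (hj : Function.Injective j) (s : σ) :
    sliceHom (R := R) j (X (j s)) = C (X s) := by
  have h : ∃ s', j s' = j s := ⟨s, rfl⟩
  rw [sliceHom, aeval_X, dif_pos h, hj h.choose_spec]

lemma sliceHom_X_of_notMem {j : σ → τ} {t : τ} (ht : t ∉ Set.range j) :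
    sliceHom (R := R) j (X t) = X t := by
  rw [sliceHom, aeval_X]
  exact dif_neg ht

/-- The coefficient of exponent `ρ` in the variables outside the range of `j`. -/
noncomputable def slice (j : σ → τ) (ρ : τ →₀ ℕ) (f : MvPolynomial τ R) : MvPolynomial σ R :=
  coeff ρ (sliceHom j f)

lemma sliceHom_monomial {j : σ → τ} (hj : Function.Injective j) (e : σ →₀ ℕ) {ρ : τ →₀ ℕ}
    (hρ : ∀ s, ρ (j s) = 0) (a : R) :
    sliceHom j (monomial (e.mapDomain j + ρ) a) = monomial ρ (monomial e a) := by
  have h1 : (sliceHom j).comp (rename j) =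
      IsScalarTower.toAlgHom R (MvPolynomial σ R) (MvPolynomial τ (MvPolynomial σ R)) := by
    ext1 s
    simp [sliceHom_X_apply hj, algebraMap_eq]
  have h2 : sliceHom j (monomial (e.mapDomain j) a) = C (monomial e a) := by
    rw [← rename_monomial]
    simpa [algebraMap_eq] using congrArg (fun ψ => ψ (monomial e a)) h1
  have h3 : sliceHom j (monomial ρ (1 : R)) = monomial ρ 1 := by
    rw [monomial_eq, monomial_eq, map_mul, C_1, map_one, C_1, Finsupp.prod, Finsupp.prod, map_prod]
    congr 1
    refine Finset.prod_congr rfl fun t ht => ?_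
    rw [map_pow, sliceHom_X_of_notMem]
    rintro ⟨s, rfl⟩
    exact Finsupp.mem_support_iff.1 ht (hρ s)
  rw [← mul_one a, ← monomial_mul, map_mul, h2, h3, C_mul_monomial, mul_one, mul_one]

lemma mapDomain_comapDomain_add_filter {j : σ → τ} (hj : Function.Injective j)
    [DecidablePred fun t => t ∉ Set.range j] (u : τ →₀ ℕ) :
    (u.comapDomain j hj.injOn).mapDomain j + u.filter (fun t => t ∉ Set.range j) = u := by
  ext t
  rw [Finsupp.add_apply]
  by_cases ht : t ∈ Set.range j
  · obtain ⟨s, rfl⟩ := ht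
    rw [Finsupp.mapDomain_apply hj, Finsupp.comapDomain_apply,
      Finsupp.filter_apply_neg _ _ (by simp), add_zero]
  · rw [Finsupp.mapDomain_of_notMem_range _ _ ht, zero_add, Finsupp.filter_apply_pos (fun t => t ∉ Set.range j) _ ht]

lemma mapDomain_add_inj {j : σ → τ} (hj : Function.Injective j) {e e' : σ →₀ ℕ} {ρ ρ' : τ →₀ ℕ}
    (hρ : ∀ s, ρ (j s) = 0) (hρ' : ∀ s, ρ' (j s) = 0)
    (h : e.mapDomain j + ρ = e'.mapDomain j + ρ') : e = e' ∧ ρ = ρ' := by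
  have he : e = e' := by
    ext s
    simpa [Finsupp.mapDomain_apply hj, hρ, hρ'] using DFunLike.congr_fun h (j s)
  subst he
  exact ⟨rfl, add_left_cancel h⟩

lemma coeff_slice {j : σ → τ} (hj : Function.Injective j) {ρ : τ →₀ ℕ}
    (hρ : ∀ s, ρ (j s) = 0) (e : σ →₀ ℕ) (f : MvPolynomial τ R) :
    coeff e (slice j ρ f) = coeff (e.mapDomain j + ρ) f := by
  classical
  induction f using MvPolynomial.induction_on' with
  | monomial u a =>
    obtain ⟨e', ρ', hρ', rfl⟩ : ∃ (e' : σ →₀ ℕ) (ρ' : τ →₀ ℕ), (∀ s, ρ' (j s) = 0) ∧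
        e'.mapDomain j + ρ' = u :=
      ⟨_, _, fun s => Finsupp.filter_apply_neg (fun t => t ∉ Set.range j) _ (by simp),
        mapDomain_comapDomain_add_filter hj u⟩
    rw [slice, sliceHom_monomial hj e' hρ', coeff_monomial, coeff_monomial]
    by_cases h : e'.mapDomain j + ρ' = e.mapDomain j + ρ
    · obtain ⟨rfl, rfl⟩ := mapDomain_add_inj hj hρ' hρ h
      simp
    · rw [if_neg h]
      by_cases h' : ρ' = ρ
      · rw [if_pos h', coeff_monomial, if_neg]
        rintro rfl
        exact h (by rw [h'])
      · rw [if_neg h', coeff_zero]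
  | add f g hf hg =>
    rw [slice, map_add, coeff_add, coeff_add, coeff_add, ← hf, ← hg, slice, slice]

lemma slice_translate {j : σ → τ} (hj : Function.Injective j) (ρ : τ →₀ ℕ) {w : τ → R}
    (hw : ∀ t, t ∉ Set.range j → w t = 0) (f : MvPolynomial τ R) :
    slice j ρ (translate w f) = translate (w ∘ j) (slice j ρ f) := by
  have h : (sliceHom j).comp (translate w) =
      (mapAlgHom (translate (w ∘ j))).comp (sliceHom j) := by
    ext1 t
    by_cases ht : t ∈ Set.range j
    · obtain ⟨s, rfl⟩ := ht
      simp [sliceHom_X_apply hj, algHom_C, IsScalarTower.algebraMap_apply R (MvPolynomial σ R)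
        (MvPolynomial τ (MvPolynomial σ R)), algebraMap_eq]
    · simp [sliceHom_X_of_notMem ht, hw t ht]
  have h' : sliceHom j (translate w f) = map (translate (w ∘ j)).toRingHom (sliceHom j f) :=
    congrArg (fun ψ => ψ f) h
  rw [slice, h', coeff_map]
  rfl

/-- Slicing acts as a transverse Hasse derivative restricted to the flat; it costs at most
`ρ.degree` orders of vanishing. -/
lemma slice_mem_pointIdeal_pow {j : σ → τ} (hj : Function.Injective j) {ρ : τ →₀ ℕ}
    (hρ : ∀ s, ρ (j s) = 0) {w : τ → R} (hw : ∀ t, t ∉ Set.range j → w t = 0)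
    {f : MvPolynomial τ R} {a : ℕ} (hf : f ∈ pointIdeal w ^ (a + ρ.degree)) :
    slice j ρ f ∈ pointIdeal (w ∘ j) ^ a := by
  rw [mem_pointIdeal_pow_iff] at hf ⊢
  intro e he
  rw [← slice_translate hj ρ hw, coeff_slice hj hρ]
  refine hf _ ?_
  rw [map_add, Finsupp.degree_mapDomain]
  omega

lemma totalDegree_slice_le {j : σ → τ} (hj : Function.Injective j) {ρ : τ →₀ ℕ}
    (hρ : ∀ s, ρ (j s) = 0) (f : MvPolynomial τ R) :
    (slice j ρ f).totalDegree ≤ f.totalDegree := by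
  refine Finset.sup_le fun e he => ?_
  rw [mem_support_iff, coeff_slice hj hρ, ← mem_support_iff] at he
  have h1 : (e.mapDomain j + ρ).degree ≤ f.totalDegree := le_totalDegree he
  rw [map_add, Finsupp.degree_mapDomain] at h1
  exact le_trans (Nat.le_add_right _ _) h1

end Slice

/-! ### Affine coordinates at a joint. -/

section LocalCoordinates

variable {𝔽 τ κ : Type*} [Field 𝔽] [Fintype τ]

/-- The expression of a polynomial in the affine coordinates with origin `p` and basis `b`. -/
noncomputable def localCoord (p : κ → 𝔽) (b : Module.Basis τ 𝔽 (κ → 𝔽)) :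
    MvPolynomial κ 𝔽 →ₐ[𝔽] MvPolynomial τ 𝔽 :=
  aeval fun c => C (p c) + ∑ t, C (b t c) * X t

lemma localCoord_mem_pointIdeal_pow {p q : κ → 𝔽} (b : Module.Basis τ 𝔽 (κ → 𝔽)) {w : τ → 𝔽}
    (hq : q = p + ∑ t, w t • b t) {f : MvPolynomial κ 𝔽} {m : ℕ}
    (hf : f ∈ pointIdeal q ^ m) : localCoord p b f ∈ pointIdeal w ^ m := by
  refine algHom_mem_pointIdeal_pow _ (fun c => ?_) hf
  simp [localCoord, hq, mul_comm]

lemma totalDegree_localCoord_le (p : κ → 𝔽) (b : Module.Basis τ 𝔽 (κ → 𝔽))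
    (f : MvPolynomial κ 𝔽) : (localCoord p b f).totalDegree ≤ f.totalDegree := by
  refine totalDegree_aeval_le _ (fun c => ?_) f
  rw [localCoord, aeval_X]
  refine (totalDegree_add _ _).trans (max_le (by simp) ?_)
  refine totalDegree_finsetSum_le fun t _ => ?_
  refine (totalDegree_mul _ _).trans ?_
  simp

variable [Fintype κ]

/-- The inverse of `localCoord`. -/
noncomputable def localCoordInv (p : κ → 𝔽) (b : Module.Basis τ 𝔽 (κ → 𝔽)) :
    MvPolynomial τ 𝔽 →ₐ[𝔽] MvPolynomial κ 𝔽 :=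
  haveI := Classical.decEq κ
  aeval fun t => ∑ c, C (b.repr (Pi.single c 1) t) * (X c - C (p c))

lemma localCoordInv_localCoord (p : κ → 𝔽) (b : Module.Basis τ 𝔽 (κ → 𝔽))
    (f : MvPolynomial κ 𝔽) : localCoordInv p b (localCoord p b f) = f := by
  classical
  have h : (localCoordInv p b).comp (localCoord p b) = AlgHom.id 𝔽 _ := by
    ext1 c
    have hb : ∀ c', ∑ t, b t c * b.repr (Pi.single c' 1) t = (Pi.single c' 1 : κ → 𝔽) c := by
      intro c'
      conv_rhs => rw [← b.sum_repr (Pi.single c' 1)]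
      simp [mul_comm]
    simp only [AlgHom.comp_apply, localCoord, localCoordInv, aeval_X, map_add, map_sum, map_mul,
      algHom_C, algebraMap_eq, AlgHom.id_apply, Finset.mul_sum]
    rw [Finset.sum_comm]
    simp only [← mul_assoc, ← Finset.sum_mul, ← C_mul, ← map_sum]
    rw [Finset.sum_eq_single c]
    · have := hb c
      rw [Pi.single_eq_same] at this
      rw [this, C_1]
      ring
    · intro c' _ hc
      have := hb c'
      rw [Pi.single_eq_of_ne hc.symm] at this
      rw [this, C_0, zero_mul]
    · simp
  exact congrArg (fun ψ => ψ f) h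

lemma mem_pointIdeal_pow_of_localCoord {p : κ → 𝔽} (b : Module.Basis τ 𝔽 (κ → 𝔽))
    {f : MvPolynomial κ 𝔽} {m : ℕ} (hf : localCoord p b f ∈ pointIdeal 0 ^ m) :
    f ∈ pointIdeal p ^ m := by
  rw [← localCoordInv_localCoord p b f]
  refine algHom_mem_pointIdeal_pow _ (fun t => ?_) hf
  simp [localCoordInv]

end LocalCoordinates

/-! ### From standard exponents on flats to the ambient polynomial space. -/

section JointInequality

variable {𝔽 : Type*} [Field 𝔽] {ι : Type*} [LinearOrder ι] {r d : ℕ} {k : Fin r → ℕ}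

/-- The inclusion of the `i`-th group of variables. -/
def groupVar (k : Fin r → ℕ) (i : Fin r) (s : Fin (k i)) : Σ i, Fin (k i) := ⟨i, s⟩

lemma groupVar_injective (i : Fin r) : Function.Injective (groupVar k i) :=
  fun _ _ h => eq_of_heq (Sigma.mk.inj h).2

lemma notMem_range_groupVar {i i' : Fin r} (h : i' ≠ i) (s : Fin (k i')) :
    (⟨i', s⟩ : Σ i, Fin (k i)) ∉ Set.range (groupVar k i) := by
  rintro ⟨s', hs'⟩
  exact h (congrArg Sigma.fst hs').symm

/-- The exponent in the variables of the `i`-th group. -/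
noncomputable def expPart (ε : (Σ i, Fin (k i)) →₀ ℕ) (i : Fin r) : Fin (k i) →₀ ℕ :=
  ε.comapDomain (groupVar k i) (groupVar_injective i).injOn

lemma expPart_apply (ε : (Σ i, Fin (k i)) →₀ ℕ) (i : Fin r) (s : Fin (k i)) :
    expPart ε i s = ε ⟨i, s⟩ := rfl

open Classical in
/-- The exponent in the variables outside the `i`-th group. -/
noncomputable def expRest (ε : (Σ i, Fin (k i)) →₀ ℕ) (i : Fin r) : (Σ i, Fin (k i)) →₀ ℕ :=
  ε.filter fun t => t ∉ Set.range (groupVar k i)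

lemma expPart_add_expRest (ε : (Σ i, Fin (k i)) →₀ ℕ) (i : Fin r) :
    (expPart ε i).mapDomain (groupVar k i) + expRest ε i = ε := by
  classical
  exact mapDomain_comapDomain_add_filter (groupVar_injective i) ε

lemma expRest_groupVar (ε : (Σ i, Fin (k i)) →₀ ℕ) (i : Fin r) (s : Fin (k i)) :
    expRest ε i (groupVar k i s) = 0 := by
  classical
  exact Finsupp.filter_apply_neg (fun t => t ∉ Set.range (groupVar k i)) _ (by simp)

lemma expPart_mapDomain_add_expRest (ε : (Σ i, Fin (k i)) →₀ ℕ) (i : Fin r)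
    (e : Fin (k i) →₀ ℕ) :
    expPart (e.mapDomain (groupVar k i) + expRest ε i) = Function.update (expPart ε) i e := by
  classical
  funext i'
  ext s
  by_cases h : i' = i
  · subst h
    rw [Function.update_self, expPart_apply, Finsupp.add_apply]
    change Finsupp.mapDomain (groupVar k i') e (groupVar k i' s) +
      expRest ε i' (groupVar k i' s) = e s
    rw [expRest_groupVar, add_zero, Finsupp.mapDomain_apply (groupVar_injective i')]
  · have hs := notMem_range_groupVar h s
    rw [Function.update_of_ne h, expPart_apply, expPart_apply, Finsupp.add_apply,
      Finsupp.mapDomain_of_notMem_range _ _ hs, zero_add, expRest,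
      Finsupp.filter_apply_pos (fun t => t ∉ Set.range (groupVar k i)) _ hs]

lemma degree_expPart_add_degree_expRest (ε : (Σ i, Fin (k i)) →₀ ℕ) (i : Fin r) :
    (expPart ε i).degree + (expRest ε i).degree = ε.degree := by
  conv_rhs => rw [← expPart_add_expRest ε i, map_add, Finsupp.degree_mapDomain]

lemma exists_standard_coeff_ne_zero [Fintype ι] {pt : ι → Fin d → 𝔽}
    {b : ι → Module.Basis (Σ i, Fin (k i)) 𝔽 (Fin d → 𝔽)} {S : Fin r → ι → Finset ι}
    {x : ∀ i, ι → Fin (k i) → 𝔽}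
    (hS : ∀ i p, ∀ q ∈ S i p, pt q = pt p + ∑ s, (x i q s - x i p s) • b p ⟨i, s⟩)
    {β : ι → ℕ} {n : ℕ} {L : Finset ι} (hL : L.Nonempty)
    (hgap : ∀ p ∈ L, ∀ q ∉ L, β q + n < β p)
    {g : MvPolynomial (Fin d) 𝔽} (hg : g ≠ 0) (hn : g.totalDegree ≤ n) :
    ∃ p ∈ L, ∃ ε, coeff ε (localCoord (pt p) (b p) g) ≠ 0 ∧
      ∀ i, expPart ε i ∈ stdExp β (S i p) (x i) n p := by
  classical
  obtain ⟨q₀, hq₀⟩ := hL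
  obtain ⟨p, -, m, hmn, hm, hm', hearlier⟩ :=
    exists_first_nonvanishing β (S := Finset.univ) ⟨q₀, Finset.mem_univ _⟩ pt hg hn
  -- If `p` were outside `L`, the gap would put all orders up to `n` at `q₀` before any condition at
  -- `p`, forcing `g = 0`.
  have hpL : p ∈ L := by
    by_contra hp
    refine hg (eq_zero_of_mem_pointIdeal_pow hn (hearlier q₀ (Finset.mem_univ _) n ?_))
    have := hgap q₀ hq₀ p hp
    exact key_lt_key.2 (Or.inl (by omega))
  set G := localCoord (pt p) (b p) g with hG
  have hG0 : ∀ ε : (Σ i, Fin (k i)) →₀ ℕ, ε.degree < m → coeff ε G = 0 := by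
    have := localCoord_mem_pointIdeal_pow (b p) (p := pt p) (q := pt p) (w := 0) (by simp) hm
    rw [mem_pointIdeal_pow_iff] at this
    simpa [translate_zero] using this
  obtain ⟨ε₀, hε₀, hε₀'⟩ : ∃ ε : (Σ i, Fin (k i)) →₀ ℕ, ε.degree = m ∧ coeff ε G ≠ 0 := by
    by_contra! hcon
    refine hm' (mem_pointIdeal_pow_of_localCoord (b p) ?_)
    rw [mem_pointIdeal_pow_iff]
    intro ε hε
    rw [translate_zero]
    rcases (Nat.lt_succ_iff.1 hε).lt_or_eq with h | h
    · exact hG0 ε h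
    · exact hcon ε h
  -- Minimality is for the product of the `r` lexicographic orders: lowering a single part, with its
  -- degree kept, already gives a smaller exponent. This serves all flats at once.
  let P : ((Σ i, Fin (k i)) →₀ ℕ) → ∀ i, Lex (Fin (k i) →₀ ℕ) := fun ε i => toLex (expPart ε i)
  obtain ⟨ε, hε, hmin⟩ := (G.support.filter fun ε => ε.degree = m).exists_minimalFor P
    ⟨ε₀, by simpa using ⟨hε₀', hε₀⟩⟩
  rw [Finset.mem_filter, mem_support_iff] at hε
  refine ⟨p, hpL, ε, hε.1, fun i => ?_⟩
  have hinj := groupVar_injective (k := k) i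
  have hdeg := degree_expPart_add_degree_expRest ε i
  have hcoeff : ∀ e, coeff e (translate (x i p) (translate (-(x i p))
      (slice (groupVar k i) (expRest ε i) G))) = coeff (e.mapDomain (groupVar k i) + expRest ε i) G := by
    intro e
    rw [translate_translate_neg, coeff_slice hinj (expRest_groupVar ε i)]
  -- The slice is centred at the joint; the translation returns it to the coordinates of the flat.
  -- Ranks are differences, so the loss of `(expRest ε i).degree` orders preserves comparisons.
  refine ⟨translate (-(x i p)) (slice (groupVar k i) (expRest ε i) G), ?_, ?_, ?_, ?_⟩
  · exact (totalDegree_translate_le _ _).trans ((totalDegree_slice_le hinj (expRest_groupVar ε i) G).trans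
      ((totalDegree_localCoord_le _ _ _).trans hn))
  · intro q hq a ha
    let w : (Σ i, Fin (k i)) → 𝔽 := fun t =>
      if h : t.1 = i then x i q (h ▸ t.2) - x i p (h ▸ t.2) else 0
    have hw : ∀ s, w ⟨i, s⟩ = x i q s - x i p s := fun s => by simp [w]
    have hw' : ∀ t, t ∉ Set.range (groupVar k i) → w t = 0 := by
      rintro ⟨i', s⟩ ht
      refine dif_neg ?_
      rintro rfl
      exact ht ⟨s, rfl⟩
    have hqw : pt q = pt p + ∑ t, w t • b p t := by
      rw [hS i p q hq, Fintype.sum_sigma, Finset.sum_eq_single i]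
      · simp only [hw]
      · intro i' _ hi'
        refine Finset.sum_eq_zero fun s _ => ?_
        rw [hw' _ (notMem_range_groupVar hi' s), zero_smul]
      · simp
    have hgq := hearlier q (Finset.mem_univ _) (a + (expRest ε i).degree) (by
      rw [key_lt_key] at ha ⊢
      exact ha.imp (fun h => by omega) fun h => ⟨by omega, h.2⟩)
    have hGq := localCoord_mem_pointIdeal_pow (b p) hqw hgq
    rw [show a + (expRest ε i).degree + 1 = a + 1 + (expRest ε i).degree by omega] at hGq
    refine translate_mem_pointIdeal_pow ?_ (slice_mem_pointIdeal_pow hinj (expRest_groupVar ε i) hw' hGq)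
    funext s
    have : w (groupVar k i s) = x i q s - x i p s := hw s
    rw [Pi.add_apply, Function.comp_apply, this, Pi.neg_apply, sub_eq_add_neg]
  · intro e hd hlt
    rw [hcoeff]
    by_contra hcon
    have hP : P (e.mapDomain (groupVar k i) + expRest ε i) = Function.update (P ε) i (toLex e) := by
      funext i'
      simp only [P, expPart_mapDomain_add_expRest]
      by_cases h : i' = i
      · subst h
        simp
      · simp [Function.update_of_ne h]
    have hlt' : P (e.mapDomain (groupVar k i) + expRest ε i) < P ε := by
      rw [hP]
      exact update_lt_self_iff.2 hlt
    refine not_le_of_gt hlt' (hmin ?_ hlt'.le)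
    change _ ∈ Finset.filter _ _
    rw [Finset.mem_filter, mem_support_iff]
    refine ⟨hcon, ?_⟩
    rw [map_add, Finsupp.degree_mapDomain]
    omega
  · rw [hcoeff, expPart_add_expRest]
    exact hε.1

/-- The coefficients whose parts are all standard determine a polynomial of degree at most `n`. -/
theorem choose_le_sum_prod_ncard_stdExp [Fintype ι] {pt : ι → Fin d → 𝔽}
    {b : ι → Module.Basis (Σ i, Fin (k i)) 𝔽 (Fin d → 𝔽)} {S : Fin r → ι → Finset ι}
    {x : ∀ i, ι → Fin (k i) → 𝔽}
    (hS : ∀ i p, ∀ q ∈ S i p, pt q = pt p + ∑ s, (x i q s - x i p s) • b p ⟨i, s⟩)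
    {β : ι → ℕ} {n : ℕ} {L : Finset ι} (hL : L.Nonempty)
    (hgap : ∀ p ∈ L, ∀ q ∉ L, β q + n < β p) :
    (n + d).choose d ≤ ∑ p ∈ L, ∏ i, (stdExp β (S i p) (x i) n p).ncard := by
  classical
  let T := Σ p : L, ∀ i, stdExp β (S i p) (x i) n p.1
  have := Fintype.ofFinite T
  let E : (∀ i, Fin (k i) →₀ ℕ) → ((Σ i, Fin (k i)) →₀ ℕ) :=
    Finsupp.sigmaFinsuppEquivPiFinsupp.symm
  have hE : ∀ ε, E (expPart ε) = ε := fun ε => by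
    rw [Equiv.symm_apply_eq]
    funext i
    ext s
    rw [Finsupp.sigmaFinsuppEquivPiFinsupp_apply, expPart_apply]
  let c : restrictTotalDegree (Fin d) 𝔽 n →ₗ[𝔽] (T → 𝔽) :=
    LinearMap.pi fun t => lcoeff 𝔽 (E fun i => (t.2 i).1) ∘ₗ
      (localCoord (pt t.1) (b t.1)).toLinearMap ∘ₗ Submodule.subtype _
  have hc : Function.Injective c := by
    rw [injective_iff_map_eq_zero]
    rintro ⟨g, hg⟩ hcg
    rw [mem_restrictTotalDegree] at hg
    by_contra hne
    have hg0 : g ≠ 0 := fun h => hne (Subtype.ext h)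
    obtain ⟨p, hp, ε, hε, hmem⟩ := exists_standard_coeff_ne_zero hS hL hgap hg0 hg
    have h : coeff (E (expPart ε)) (localCoord (pt p) (b p) g) = 0 :=
      congrFun hcg ⟨⟨p, hp⟩, fun i => ⟨expPart ε i, hmem i⟩⟩
    rw [hE] at h
    exact hε h
  have h := LinearMap.finrank_le_finrank_of_injective hc
  rw [Module.finrank_fintype_fun_eq_card, ← Nat.card_eq_fintype_card, Nat.card_sigma,
    finrank_restrictTotalDegree, Fintype.card_fin] at h
  simp only [Nat.card_pi, Nat.card_coe_set_eq] at h
  rwa [Finset.sum_coe_sort L fun p => ∏ i, (stdExp β (S i p) (x i) n p).ncard] at h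

end JointInequality

end MultijointBound

namespace MultijointBound

/-! ### Choosing the handicaps. -/

section Balancing

/-- If handicaps may be raised one at a time, each raise increasing only the weight of the raised
point and that by little, then some choice of handicaps makes all the weights large. -/
lemma exists_balanced {ι : Type*} [Fintype ι] [DecidableEq ι] (W : (ι → ℕ) → ι → ℝ) (n : ℕ)
    {M τ τ' : ℝ}
    (hself : ∀ β p, W β p < τ → W (Function.update β p (β p + 1)) p ≤ τ')
    (hother : ∀ β p q, q ≠ p → W (Function.update β p (β p + 1)) q ≤ W β q)
    (hgap : ∀ β (L : Finset ι), L.Nonempty → (∀ p ∈ L, ∀ q ∉ L, β q + n < β p) →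
      M ≤ ∑ p ∈ L, W β p)
    (hτ' : 0 ≤ τ') (hM : Fintype.card ι * τ' < M) : ∃ β, ∀ p, τ ≤ W β p := by
  -- Raising a point of weight below `τ` preserves fairness, and fair handicaps are bounded; so one
  -- of maximal total has no such point.
  let fair : Set (ι → ℕ) := {β | ∀ p, 0 < β p → W β p ≤ τ'}
  have hbound : ∀ β ∈ fair, ∀ p₀, β p₀ ≤ (Fintype.card ι + 1) * (n + 1) := by
    intro β hβ p₀
    by_contra! hp₀
    -- Pigeonhole: the points other than `p₀` cannot meet all the blocks of length `n + 1` numbered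
    -- from `1` to `card ι`. The points above an empty block are separated by a gap, yet too light
    -- for `hgap`.
    have hcard : ((Finset.univ.erase p₀).image fun p => β p / (n + 1)).card <
        (Finset.Icc 1 (Fintype.card ι)).card := by
      refine Finset.card_image_le.trans_lt ?_
      rw [Nat.card_Icc, Finset.card_erase_of_mem (Finset.mem_univ _), Finset.card_univ]
      have := Fintype.card_pos_iff.2 ⟨p₀⟩
      omega
    obtain ⟨j, hj, hj'⟩ := Finset.exists_mem_notMem_of_card_lt_card hcard
    rw [Finset.mem_Icc] at hj
    have hslot : ∀ p, β p < j * (n + 1) ∨ (j + 1) * (n + 1) ≤ β p := by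
      intro p
      by_cases hp : p = p₀
      · subst hp
        exact Or.inr ((Nat.mul_le_mul_right _ (by omega)).trans hp₀.le)
      · by_contra! hcon
        refine hj' (Finset.mem_image.2 ⟨p, by simp [hp], ?_⟩)
        exact Nat.div_eq_of_lt_le hcon.1 hcon.2
    let L : Finset ι := Finset.univ.filter fun p => (j + 1) * (n + 1) ≤ β p
    have hL : ∀ p ∈ L, W β p ≤ τ' := by
      intro p hp
      refine hβ p (lt_of_lt_of_le ?_ (Finset.mem_filter.1 hp).2)
      positivity
    have h1 : M ≤ ∑ p ∈ L, W β p := by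
      refine hgap β L ⟨p₀, ?_⟩ ?_
      · simp only [L, Finset.mem_filter, Finset.mem_univ, true_and]
        exact (Nat.mul_le_mul_right _ (by omega)).trans hp₀.le
      · intro p hp q hq
        simp only [L, Finset.mem_filter, Finset.mem_univ, true_and] at hp hq
        have h2 := (hslot q).resolve_right hq
        have h3 : (j + 1) * (n + 1) = j * (n + 1) + (n + 1) := by ring
        omega
    have h2 : ∑ p ∈ L, W β p ≤ L.card * τ' := by
      simpa using Finset.sum_le_card_nsmul L _ _ hL
    have h3 : (L.card : ℝ) * τ' ≤ Fintype.card ι * τ' :=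
      mul_le_mul_of_nonneg_right (by exact_mod_cast Finset.card_le_univ L) hτ'
    linarith
  have hfin : fair.Finite :=
    (Set.finite_Iic (fun _ : ι => (Fintype.card ι + 1) * (n + 1))).subset hbound
  obtain ⟨β, hβ, hmax⟩ := Set.exists_max_image fair (fun β => ∑ p, β p) hfin
    ⟨0, fun p hp => absurd hp (lt_irrefl 0)⟩
  refine ⟨β, fun p => ?_⟩
  by_contra! hp
  have hfair : Function.update β p (β p + 1) ∈ fair := by
    intro q hq
    by_cases hqp : q = p
    · subst hqp
      exact hself β q hp
    · rw [Function.update_of_ne hqp] at hq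
      exact (hother β p q hqp).trans (hβ q hq)
  have h := hmax _ hfair
  have hlt : ∑ q, β q < ∑ q, Function.update β p (β p + 1) q := by
    refine Finset.sum_lt_sum (fun q _ => ?_) ⟨p, Finset.mem_univ _, by simp⟩
    by_cases hqp : q = p
    · subst hqp
      simp
    · rw [Function.update_of_ne hqp]
  exact absurd h (not_le.2 hlt)

end Balancing

/-! ### Inequalities for products. -/

section Inequalities

/-- A product grows more when its factors start larger and grow more. This bounds the increase of a
weight by a quantity independent of the handicaps. -/
lemma prod_add_prod_le {κ : Type*} (s : Finset κ) (B B' C C' : κ → ℝ) (hB : ∀ i, 0 ≤ B i)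
    (hB' : ∀ i, 0 ≤ B' i) (hC : ∀ i, C i ≤ C' i) (hBC : ∀ i, B i ≤ C i)
    (h : ∀ i, B' i + C i ≤ B i + C' i) :
    ∏ i ∈ s, B' i + ∏ i ∈ s, C i ≤ ∏ i ∈ s, B i + ∏ i ∈ s, C' i := by
  classical
  induction s using Finset.induction_on with
  | empty => simp
  | insert a s ha ih =>
    rw [Finset.prod_insert ha, Finset.prod_insert ha, Finset.prod_insert ha,
      Finset.prod_insert ha]
    have h1 : ∏ i ∈ s, B i ≤ ∏ i ∈ s, C i :=
      Finset.prod_le_prod (fun i _ => hB i) fun i _ => hBC i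
    have h2 : ∏ i ∈ s, C i ≤ ∏ i ∈ s, C' i :=
      Finset.prod_le_prod (fun i _ => (hB i).trans (hBC i)) fun i _ => hC i
    have h3 : 0 ≤ ∏ i ∈ s, B i := Finset.prod_nonneg fun i _ => hB i
    have h4 : 0 ≤ ∏ i ∈ s, B' i := Finset.prod_nonneg fun i _ => hB' i
    have ha1 := h a
    have ha2 := hBC a
    have ha3 := hB a
    have ha4 := hC a
    have ha5 := hB' a
    generalize ∏ i ∈ s, B i = X at *
    generalize ∏ i ∈ s, B' i = X' at *
    generalize ∏ i ∈ s, C i = Y at *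
    generalize ∏ i ∈ s, C' i = Y' at *
    have e1 : B' a * X' ≤ (B a + (C' a - C a)) * X' :=
      mul_le_mul_of_nonneg_right (by linarith) h4
    have e2 : (B a + (C' a - C a)) * X' ≤ (B a + (C' a - C a)) * (X + (Y' - Y)) :=
      mul_le_mul_of_nonneg_left (by linarith) (by linarith)
    have e3 : 0 ≤ (C a - B a) * (Y' - Y) := mul_nonneg (by linarith) (by linarith)
    have e4 : 0 ≤ (C' a - C a) * (Y - X) := mul_nonneg (by linarith) (by linarith)
    nlinarith

/-- A Hölder-type inequality: if all products `∏ i, B p i` are at least `τ`, then `τ` times the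
`r`-th power of the number of points is at most the product of the sums. -/
lemma card_pow_mul_le_prod {ι : Type*} [Fintype ι] {r : ℕ} (hr : 0 < r) (B : ι → Fin r → ℝ)
    (Q : Fin r → ℝ) {τ : ℝ} (hτ : 0 ≤ τ) (hB : ∀ p i, 0 ≤ B p i) (hQ : ∀ i, 0 < Q i)
    (hsum : ∀ i, ∑ p, B p i ≤ Q i) (hprod : ∀ p, τ ≤ ∏ i, B p i) :
    (Fintype.card ι : ℝ) ^ r * τ ≤ ∏ i, Q i := by
  have hr' : (0 : ℝ) < r := by exact_mod_cast hr
  have hR : 0 < ∏ i, Q i := Finset.prod_pos fun i _ => hQ i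
  set R := ∏ i, Q i
  set y := (τ / R) ^ (r : ℝ)⁻¹ with hy
  have hy0 : 0 ≤ y := Real.rpow_nonneg (by positivity) _
  have hpt : ∀ p, y ≤ ∑ i, (r : ℝ)⁻¹ * (B p i / Q i) := by
    intro p
    have h := Real.geom_mean_le_arith_mean_weighted Finset.univ (fun _ : Fin r => (r : ℝ)⁻¹)
      (fun i => B p i / Q i) (fun _ _ => by positivity) (by simp [hr'.ne'])
      (fun i _ => div_nonneg (hB p i) (hQ i).le)
    refine le_trans ?_ h
    rw [Real.finsetProd_rpow _ _ (fun i _ => div_nonneg (hB p i) (hQ i).le),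
      Finset.prod_div_distrib]
    exact Real.rpow_le_rpow (by positivity) (div_le_div_of_nonneg_right (hprod p) hR.le)
      (by positivity)
  have hle : (Fintype.card ι : ℝ) * y ≤ 1 := by
    calc (Fintype.card ι : ℝ) * y = ∑ _p : ι, y := by simp
      _ ≤ ∑ p, ∑ i, (r : ℝ)⁻¹ * (B p i / Q i) := Finset.sum_le_sum fun p _ => hpt p
      _ = ∑ i, (r : ℝ)⁻¹ * ((∑ p, B p i) / Q i) := by
        rw [Finset.sum_comm]
        refine Finset.sum_congr rfl fun i _ => ?_
        rw [← Finset.mul_sum, Finset.sum_div]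
      _ ≤ ∑ _i : Fin r, (r : ℝ)⁻¹ * 1 := by
        refine Finset.sum_le_sum fun i _ => mul_le_mul_of_nonneg_left ?_ (by positivity)
        rw [div_le_one (hQ i)]
        exact hsum i
      _ = 1 := by simp [hr'.ne']
  have hpow : ((Fintype.card ι : ℝ) * y) ^ r ≤ 1 := pow_le_one₀ (by positivity) hle
  rw [mul_pow, hy, Real.rpow_inv_natCast_pow (by positivity) hr.ne', ← mul_div_assoc,
    div_le_one hR] at hpow
  exact hpow

end Inequalities

/-! ### Binomial coefficients for large degree. -/

section Asymptotics

open Filter Topology Asymptotics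

lemma tendsto_choose_div_pow (a k : ℕ) :
    Tendsto (fun n : ℕ => ((n + a + k).choose k : ℝ) / (n : ℝ) ^ k) atTop
      (𝓝 (1 / (k.factorial : ℝ))) := by
  have h1 : (fun n : ℕ => ((n + (a + k)).choose k : ℝ)) ~[atTop]
      (fun n : ℕ => ((n + (a + k) : ℕ) : ℝ) ^ k / k.factorial) :=
    (isEquivalent_choose k).comp_tendsto (tendsto_add_atTop_nat (a + k))
  have h2 : (fun n : ℕ => ((n + (a + k) : ℕ) : ℝ)) ~[atTop] (fun n : ℕ => (n : ℝ)) := by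
    have hc : (fun _ : ℕ => ((a + k : ℕ) : ℝ)) =o[atTop] (fun n : ℕ => (n : ℝ)) :=
      isLittleO_const_left.2 (Or.inr (tendsto_norm_atTop_atTop.comp tendsto_natCast_atTop_atTop))
    have := (IsEquivalent.refl (u := fun n : ℕ => (n : ℝ)) (l := atTop)).add_isLittleO hc
    refine this.congr_left (Eventually.of_forall fun n => ?_)
    simp
  have h3 := h1.trans ((h2.pow k).div (IsEquivalent.refl (u := fun _ => (k.factorial : ℝ))))
  have h4 : ∀ᶠ n : ℕ in atTop, (n : ℝ) ^ k / k.factorial ≠ 0 := by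
    filter_upwards [eventually_gt_atTop 0] with n hn
    positivity
  have h5 := ((isEquivalent_iff_tendsto_one h4).1 h3).div_const (k.factorial : ℝ)
  refine h5.congr' ?_
  filter_upwards [eventually_gt_atTop 0] with n hn
  have : (k.factorial : ℝ) ≠ 0 := by positivity
  have : (n : ℝ) ^ k ≠ 0 := by positivity
  simp only [Pi.div_apply, ← add_assoc]
  field_simp

/-- Both products are asymptotic to `n ^ d / ∏ (k i)!`, while `(n + d).choose d` is asymptotic to `n
^ d / d!`. The `+ 1` makes the first comparison strict in the limit. -/
lemma exists_degree {r : ℕ} (k : Fin r → ℕ) {d : ℕ} (hd : d = ∑ i, k i) (N : ℕ) :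
    ∃ n : ℕ, (∏ i, ((n + k i).choose (k i) : ℝ)) ≤ (d.factorial + 1) * ((n + d).choose d : ℝ) ∧
      2 * N * ((∏ i, ((n + N + k i).choose (k i) : ℝ)) - ∏ i, ((n + k i).choose (k i) : ℝ)) <
        ((n + d).choose d : ℝ) := by
  have hC : ∀ a : ℕ, Tendsto (fun n : ℕ => (∏ i, ((n + a + k i).choose (k i) : ℝ)) / (n : ℝ) ^ d)
      atTop (𝓝 (∏ i, 1 / ((k i).factorial : ℝ))) := by
    intro a
    have h := tendsto_finsetProd Finset.univ fun i _ => tendsto_choose_div_pow a (k i)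
    refine h.congr fun n => ?_
    rw [Finset.prod_div_distrib, Finset.prod_pow_eq_pow_sum, hd]
  have hM := tendsto_choose_div_pow 0 d
  have hC0 := hC 0
  simp only [add_zero] at hM hC0
  have hdf : (0 : ℝ) < d.factorial := by positivity
  have hle : (∏ i, 1 / ((k i).factorial : ℝ)) ≤ 1 := by
    refine Finset.prod_le_one (fun i _ => by positivity) fun i _ => ?_
    rw [div_le_one (by positivity)]
    exact_mod_cast Nat.succ_le_of_lt (Nat.factorial_pos _)
  have e1 := hC0.eventually_lt (hM.const_mul ((d.factorial : ℝ) + 1)) (by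
    refine hle.trans_lt ?_
    rw [mul_one_div, lt_div_iff₀ hdf]
    linarith)
  have e2 := (((hC N).sub hC0).const_mul (2 * (N : ℝ))).eventually_lt hM (by
    rw [sub_self, mul_zero]
    positivity)
  obtain ⟨n, hn, h1, h2⟩ := ((eventually_gt_atTop 0).and (e1.and e2)).exists
  have hpos : (0 : ℝ) < (n : ℝ) ^ d := by positivity
  refine ⟨n, ?_, ?_⟩
  · rw [← mul_div_assoc, div_lt_div_iff_of_pos_right hpos] at h1
    exact h1.le
  · rw [← sub_div, ← mul_div_assoc, div_lt_div_iff_of_pos_right hpos] at h2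
    exact h2

end Asymptotics

end MultijointBound

namespace MultijointBound

/-! ### Assembling the bound. -/

section Flats

variable {𝔽 : Type*} [Field 𝔽] {r d : ℕ} {k : Fin r → ℕ}

/-- The joints bound for a family given with coordinates on its flats and bases at its joints. -/
lemma pow_card_le_of_coordinates (hr : 0 < r) (hd : d = ∑ i, k i) {κ : Type*}
    {F : Fin r → Finset κ} {N : ℕ} (hN : 0 < N) {pt : Fin N → Fin d → 𝔽}
    (hpt : Function.Injective pt) {A : Fin N → Fin r → κ} (hA : ∀ p i, A p i ∈ F i)
    {b : Fin N → Module.Basis (Σ i, Fin (k i)) 𝔽 (Fin d → 𝔽)}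
    {x : ∀ i, Fin N → Fin (k i) → 𝔽}
    (hx : ∀ i p q, A q i = A p i → pt q = pt p + ∑ s, (x i q s - x i p s) • b p ⟨i, s⟩) :
    (N : ℝ) ^ r ≤ 2 * (d.factorial + 1) * N * ∏ i, ((F i).card : ℝ) := by
  classical
  obtain ⟨n, hn1, hn2⟩ := exists_degree k hd N
  let S : Fin r → κ → Finset (Fin N) := fun i B => Finset.univ.filter fun q => A q i = B
  have hS : ∀ i p q, q ∈ S i (A p i) ↔ A q i = A p i := by simp [S]
  let B : (Fin N → ℕ) → Fin N → Fin r → ℝ := fun β p i =>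
    (stdExp β (S i (A p i)) (x i) n p).ncard
  have hN' : (0 : ℝ) < N := by exact_mod_cast hN
  have hinj : ∀ i p, Set.InjOn (x i) (S i (A p i)) := by
    intro i p q hq q' hq' h
    rw [Finset.mem_coe, hS] at hq hq'
    apply hpt
    rw [hx i p q hq, hx i p q' hq', h]
  have hself : ∀ p i, p ∈ S i (A p i) := fun p i => (hS i p p).2 rfl
  have hB0 : ∀ β p i, 0 ≤ B β p i := fun β p i => Nat.cast_nonneg _
  have hsum : ∀ β i (s : κ), ∑ p ∈ S i s, B β p i ≤ ((n + k i).choose (k i) : ℝ) := by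
    intro β i s
    have h := sum_ncard_stdExp_le β (S i s) (x i) n
    calc ∑ p ∈ S i s, B β p i = ∑ p ∈ S i s, ((stdExp β (S i s) (x i) n p).ncard : ℝ) := by
          refine Finset.sum_congr rfl fun p hp => ?_
          have : A p i = s := (Finset.mem_filter.1 hp).2
          simp only [B, this]
      _ ≤ _ := by exact_mod_cast h
  have hBC : ∀ β p i, B β p i ≤ ((n + k i).choose (k i) : ℝ) := fun β p i =>
    (Finset.single_le_sum (fun q _ => hB0 β q i) (hself p i)).trans (hsum β i (A p i))
  set M : ℝ := ((n + d).choose d : ℝ) with hM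
  have hMpos : 0 < M := by
    rw [hM]
    exact_mod_cast Nat.choose_pos (by omega)
  set C := ∏ i, ((n + k i).choose (k i) : ℝ)
  set C' := ∏ i, ((n + N + k i).choose (k i) : ℝ)
  have hCC : ∀ i, ((n + k i).choose (k i) : ℝ) ≤ ((n + N + k i).choose (k i) : ℝ) := fun i => by
    exact_mod_cast Nat.choose_le_choose _ (by omega)
  have hCC' : C ≤ C' := Finset.prod_le_prod (fun i _ => Nat.cast_nonneg _) fun i _ => hCC i
  -- One raise adds at most `C' - C`, and `N * τ' = M / 2 + N * (C' - C) < M` by `hn2`.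
  obtain ⟨β, hβ⟩ := exists_balanced (fun β p => ∏ i, B β p i) n (M := M) (τ := M / (2 * N))
    (τ' := M / (2 * N) + (C' - C)) (by
      intro β p hp
      have h := prod_add_prod_le Finset.univ (B β p) (B (Function.update β p (β p + 1)) p)
        (fun i => ((n + k i).choose (k i) : ℝ)) (fun i => ((n + N + k i).choose (k i) : ℝ))
        (hB0 _ _) (hB0 _ _) hCC (hBC β p) (fun i => by
          have hcard : (S i (A p i)).card ≤ N := by
            simpa using Finset.card_le_univ (S i (A p i))
          simp only [B]
          exact_mod_cast ncard_stdExp_update_self β hcard (hinj i p) n (hself p i))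
      change _ + C ≤ _ + C' at h
      linarith) (by
      intro β p q hqp
      refine Finset.prod_le_prod (fun i _ => hB0 _ _ _) fun i _ => ?_
      exact Nat.cast_le.2 (Set.ncard_le_ncard (stdExp_update_subset_of_ne β _ (x i) n hqp)
        (finite_stdExp _ _ _ _ _))) (by
      intro β L hL hgap
      have h := choose_le_sum_prod_ncard_stdExp (k := k) (pt := pt) (b := b)
        (S := fun i p => S i (A p i)) (x := x) (fun i p q hq => hx i p q ((hS i p q).1 hq))
        hL hgap
      simp only [B, hM]
      exact_mod_cast h) (by
      have : 0 ≤ M / (2 * N) := by positivity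
      linarith) (by
      rw [Fintype.card_fin, mul_add, show (N : ℝ) * (M / (2 * N)) = M / 2 by field_simp]
      linarith)
  have hQ : ∀ i, 0 < ((F i).card : ℝ) * ((n + k i).choose (k i) : ℝ) := by
    intro i
    have h1 : 0 < (F i).card := Finset.card_pos.2 ⟨_, hA ⟨0, hN⟩ i⟩
    have h2 : 0 < (n + k i).choose (k i) := Nat.choose_pos (by omega)
    positivity
  have h := card_pow_mul_le_prod hr (B β) (fun i => ((F i).card : ℝ) * ((n + k i).choose (k i) : ℝ))
    (τ := M / (2 * N)) (by positivity) (hB0 β) hQ (fun i => by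
      rw [← Finset.sum_fiberwise_of_maps_to (s := Finset.univ) (t := F i) (g := fun p => A p i)
        (fun p _ => hA p i)]
      calc _ ≤ ∑ _s ∈ F i, ((n + k i).choose (k i) : ℝ) :=
            Finset.sum_le_sum fun s _ => hsum β i s
        _ = _ := by simp) hβ
  rw [Fintype.card_fin, Finset.prod_mul_distrib] at h
  have hF : 0 ≤ ∏ i, ((F i).card : ℝ) := Finset.prod_nonneg fun i _ => Nat.cast_nonneg _
  have h' : (N : ℝ) ^ r * (M / (2 * N)) ≤ (∏ i, ((F i).card : ℝ)) * ((d.factorial + 1) * M) :=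
    h.trans (mul_le_mul_of_nonneg_left hn1 hF)
  rw [← mul_div_assoc, div_le_iff₀ (by positivity)] at h'
  refine le_of_mul_le_mul_right (h'.trans_eq ?_) hMpos
  ring

/-- An origin and a basis are chosen once per flat, so that all joints on it share coordinates; the
bases of the `r` flats at a joint together form a basis of the space. -/
lemma pow_card_le (hr : 0 < r) (hd : d = ∑ i, k i)
    {F : Fin r → Finset (AffineSubspace 𝔽 (Fin d → 𝔽))} (hF : ∀ i, ∀ A ∈ F i, IsFlat (k i) A)
    {N : ℕ} (hN : 0 < N) {pt : Fin N → Fin d → 𝔽} (hpt : Function.Injective pt)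
    (hJ : ∀ p, pt p ∈ multijoints F) :
    (N : ℝ) ^ r ≤ 2 * (d.factorial + 1) * N * ∏ i, ((F i).card : ℝ) := by
  choose A hA hmem hind htop using hJ
  have hcoord : ∀ i (B : AffineSubspace 𝔽 (Fin d → 𝔽)), ∃ (o : Fin d → 𝔽)
      (v : Fin (k i) → Fin d → 𝔽), B ∈ F i →
        o ∈ B ∧ ∃ b : Module.Basis (Fin (k i)) 𝔽 B.direction, ∀ s, (b s : Fin d → 𝔽) = v s := by
    intro i B
    by_cases hB : B ∈ F i
    · obtain ⟨⟨o, ho⟩, _, hk⟩ := hF i B hB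
      let b := Module.finBasisOfFinrankEq 𝔽 B.direction hk
      exact ⟨o, fun s => b s, fun _ => ⟨ho, b, fun s => rfl⟩⟩
    · exact ⟨0, 0, fun h => absurd h hB⟩
  choose o v hov using hcoord
  have hov' : ∀ p i, o i (A p i) ∈ A p i ∧ ∃ b : Module.Basis (Fin (k i)) 𝔽 (A p i).direction,
      ∀ s, (b s : Fin d → 𝔽) = v i (A p i) s := fun p i => hov i _ (hA p i)
  choose ho b hb using hov'
  have hcoords : ∀ i p, ∃ x : Fin (k i) → 𝔽, pt p = o i (A p i) + ∑ s, x s • v i (A p i) s := by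
    intro i p
    let w : (A p i).direction :=
      ⟨pt p - o i (A p i), AffineSubspace.vsub_mem_direction (hmem p i) (ho p i)⟩
    refine ⟨fun s => (b p i).repr w s, ?_⟩
    have h := congrArg Subtype.val ((b p i).sum_repr w)
    simp only [AddSubmonoidClass.coe_finsetSum, Submodule.coe_smul, hb] at h
    rw [h]
    simp [w]
  choose x hx using hcoords
  have hint : ∀ p, DirectSum.IsInternal fun i => (A p i).direction := fun p =>
    (DirectSum.isInternal_submodule_iff_iSupIndep_and_iSup_eq_top _).2 ⟨hind p, htop p⟩
  refine pow_card_le_of_coordinates hr hd hN hpt hA (b := fun p => (hint p).collectedBasis (b p))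
    (x := x) ?_
  intro i p q h
  have h1 := hx i q
  have h2 := hx i p
  rw [h] at h1
  simp only [DirectSum.IsInternal.collectedBasis_coe, hb, sub_smul, Finset.sum_sub_distrib]
  rw [h1, h2]
  abel

end Flats

end MultijointBound

theorem mainTheorem5 (r : ℕ) (hr : 2 ≤ r) (k : Fin r → ℕ) (d : ℕ) (hd : d = ∑ i, k i) :
    ∃ C : ℝ, ∀ (𝔽 : Type*) [Field 𝔽] (F : Fin r → Finset (AffineSubspace 𝔽 (Fin d → 𝔽))),
      (∀ i, ∀ A ∈ F i, IsFlat (k i) A) →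
        (multijoints F).Finite ∧
          ((multijoints F).ncard : ℝ) ≤
            C * (∏ i, ((F i).card : ℝ)) ^ ((1 : ℝ) / ((r : ℝ) - 1)) := by
  set K : ℝ := 2 * (d.factorial + 1) with hK
  have hK0 : 0 ≤ K := by positivity
  refine ⟨K ^ ((1 : ℝ) / ((r : ℝ) - 1)), fun 𝔽 _ F hF => ?_⟩
  set P : ℝ := ∏ i, ((F i).card : ℝ)
  have hP0 : 0 ≤ P := Finset.prod_nonneg fun i _ => Nat.cast_nonneg _
  have hr1 : ((r - 1 : ℕ) : ℝ) = (r : ℝ) - 1 := by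
    rw [Nat.cast_sub (by omega), Nat.cast_one]
  -- A bound uniform over finite subsets yields finiteness as well as the count.
  have hbound : ∀ T : Finset (Fin d → 𝔽), (T : Set (Fin d → 𝔽)) ⊆ multijoints F →
      (T.card : ℝ) ≤ K ^ ((1 : ℝ) / ((r : ℝ) - 1)) * P ^ ((1 : ℝ) / ((r : ℝ) - 1)) := by
    intro T hT
    rcases Nat.eq_zero_or_pos T.card with h0 | hpos
    · rw [h0, Nat.cast_zero]
      positivity
    have h := MultijointBound.pow_card_le (by omega) hd hF hpos
      (pt := fun p => (T.equivFin.symm p : Fin d → 𝔽))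
      (Subtype.val_injective.comp T.equivFin.symm.injective) fun p => hT (T.equivFin.symm p).2
    have hpos' : (0 : ℝ) < T.card := by exact_mod_cast hpos
    have h' : (T.card : ℝ) ^ (r - 1) ≤ K * P := by
      refine le_of_mul_le_mul_right ?_ hpos'
      rw [← pow_succ, Nat.sub_add_cancel (by omega)]
      refine h.trans_eq ?_
      ring
    rw [← Real.mul_rpow hK0 hP0, one_div, ← hr1]
    exact (Real.le_rpow_inv_iff_of_pos (by positivity) (by positivity)
      (by exact_mod_cast (by omega : 0 < r - 1))).2 (by exact_mod_cast h')
  have hfin : (multijoints F).Finite := by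
    by_contra hinf
    obtain ⟨m, hm⟩ := exists_nat_gt
      (K ^ ((1 : ℝ) / ((r : ℝ) - 1)) * P ^ ((1 : ℝ) / ((r : ℝ) - 1)))
    obtain ⟨T, hT, hcard⟩ := Set.Infinite.exists_subset_card_eq hinf m
    have := hbound T hT
    rw [hcard] at this
    exact absurd this (not_le.2 hm)
  refine ⟨hfin, ?_⟩
  rw [Set.ncard_eq_toFinset_card _ hfin]
  exact hbound _ (by simp)
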